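/- Let $(X_i,Y_i)$, $i=1,2,\dots$, be i.i.d. with $X_i$ in a measurable space $\mathbb S$ and $Y_i\in\{0,1\}$, and let $p(x)=P(Y=1\mid X=x)$ be the true probability function. For each $n$, the first $n$ observations are split, at random and independently of the data, into a training set $D_{n_1}$ of size $n_1=n_1(n)$ and a test set $(x_{e,i},y_{e,i})$, $i=1,\dots,n_2$, of size $n_2=n_2(n)$, $n_1+n_2=n$. Let $\hat p_{D_m}:\mathbb S\to\mathbb R$ be the fitted probability that the binary regression model to be assessed yields on a sample $D_m$ of $m$ observations. Let $K$ be fixed, and let $\hat G_{D_{n_1},1},\dots,\hat G_{D_{n_1},K}$ be a partition of $\mathbb S$ determined by the training set alone. The BAGofT statistic is $$\mathrm{BAG}=\sum_{k=1}^K\frac{\Bigl(\sum_{i:\,x_{e,i}\in \hat G_{D_{n_1},k}}\{y_{e,i}-\hat p_{D_{n_1}}(x_{e,i})\}\Bigr)^2}{\sum_{i:\,x_{e,i}\in \hat G_{D_{n_1},k}}\hat p_{D_{n_1}}(x_{e,i})\{1-\hat p_{D_{n_1}}(x_{e,i})\}}.$$ Assume the null hypothesis that $p$ belongs to the model to be assessed,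 and assume: 1. for each $k=1,\dots,K$, the number $N_k=\sum_{i=1}^{n_2}\mathbf 1\{x_{e,i}\in\hat G_{D_{n_1},k}\}$ of test points in group $k$ is of order $n_2$ in probability as $n\to\infty$, i.e. $n_2/N_k$ is stochastically bounded (so $N_k\to\infty$ in probability at the rate $n_2$ when $n_2\to\infty$); 2. there is a constant $0<c_2<1/2$ with $c_2\le p(x_{e,i})\le 1-c_2$ almost surely, for all $n$ and all $i=1,\dots,n_2$; 3. under the null hypothesis, $\sup_{x\in\mathbb S}|\hat p_{D_m}(x)-p(x)|=O_p(r_m)$ as $m\to\infty$, where $D_m$ consists of $m$ i.i.d. observations from the population distribution, $r_m>0$ and $r_m\to0$. If $n_2\to\infty$ and $n_2r_{n_1}^2\to0$ as $n\to\infty$, then $\mathrm{BAG}$ converges in distribution to $\chi^2_K$, the chi-squared distribution with $K$ degrees of freedom, as $n\to\infty$. -/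

import Mathlib

open MeasureTheory ProbabilityTheory Filter Topology
open scoped ENNReal

namespace BAGofT

/-- The chi-squared distribution with `K` degrees of freedom: the law of the sum of the squares of
`K` independent standard normal random variables. -/
noncomputable def chiSquared (K : ℕ) : Measure ℝ :=
  (Measure.pi fun _ : Fin K => gaussianReal 0 1).map fun z => ∑ k, z k ^ 2

instance instIsProbabilityMeasureChiSquared (K : ℕ) : IsProbabilityMeasure (chiSquared K) :=
  Measure.isProbabilityMeasure_map
    (Finset.measurable_sum _ fun k _ => (measurable_pi_apply k).pow_const 2).aemeasurable

/-- One observation `(x, y)`: the covariates `x` and the binary response `y`. -/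
abbrev Obs (S : Type*) := S × Bool

/-- The binary response as a real number, `1` or `0`. -/
def resp (y : Bool) : ℝ := if y then 1 else 0

/-- `p` is a version of the conditional probability `x ↦ P(Y = 1 | X = x)` when `(X, Y)` has
law `P`. -/
def IsRegressionFunction {S : Type*} [MeasurableSpace S] (P : Measure (Obs S)) (p : S → ℝ) :
    Prop :=
  Measurable p ∧ (∀ x, 0 ≤ p x ∧ p x ≤ 1) ∧
    ∀ A : Set S, MeasurableSet A →
      P (A ×ˢ {true}) = ∫⁻ x in A, ENNReal.ofReal (p x) ∂P.fst

/-- A split of `n` observations into a training set of size `n₁` and a test set of size `n₂`: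
the `i`-th training observation is number `s (Sum.inl i)` of the sample, the `j`-th test
observation is number `s (Sum.inr j)`. (In particular `n₁ + n₂ = n`.) -/
abbrev Split (n₁ n₂ n : ℕ) := Fin n₁ ⊕ Fin n₂ ≃ Fin n

/-- The finite set of splits carries the discrete σ-algebra. -/
instance instMeasurableSpaceSplit (n₁ n₂ n : ℕ) : MeasurableSpace (Split n₁ n₂ n) := ⊤

/-- The training set obtained from the sequence of observations `D` and the split `s`. -/
def trainingSet {S : Type*} {n₁ n₂ n : ℕ} (D : ℕ → Obs S) (s : Split n₁ n₂ n) :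
    Fin n₁ → Obs S :=
  fun i => D (s (Sum.inl i))

/-- The test set obtained from the sequence of observations `D` and the split `s`. -/
def testSet {S : Type*} {n₁ n₂ n : ℕ} (D : ℕ → Obs S) (s : Split n₁ n₂ n) :
    Fin n₂ → Obs S :=
  fun j => D (s (Sum.inr j))

/-- The sets `G 1, …, G K` form a partition of the covariate space. -/
def IsPartition {S : Type*} {K : ℕ} (G : Fin K → Set S) : Prop :=
  Pairwise (fun k l => Disjoint (G k) (G l)) ∧ (⋃ k, G k) = Set.univ

open Classical in
/-- The indices of the test observations whose covariates lie in the group `G`. -/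
noncomputable def members {S : Type*} {m : ℕ} (t : Fin m → Obs S) (G : Set S) : Finset (Fin m) :=
  Finset.univ.filter fun i => (t i).1 ∈ G

/-- The BAGofT statistic of the test set `t`, for the fitted probability `q` and the
groups `G 1, …, G K`. -/
noncomputable def bag {S : Type*} {K m : ℕ} (q : S → ℝ) (G : Fin K → Set S)
    (t : Fin m → Obs S) : ℝ :=
  ∑ k, ((∑ i ∈ members t (G k), (resp (t i).2 - q (t i).1)) /
    √(∑ i ∈ members t (G k), q (t i).1 * (1 - q (t i).1))) ^ 2

/-- `X m = O_p(r m)` for random variables `X m ≥ 0`, where `X m` is defined on a space with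
probability measure `Q m`: for each `ε > 0` there is `M` such that `X m ≤ M * r m` outside an
event of probability at most `ε`, for all large `m`. -/
def IsBigOp {E : ℕ → Type*} [∀ m, MeasurableSpace (E m)] (Q : ∀ m, Measure (E m))
    (X : ∀ m, E m → ℝ≥0∞) (r : ℕ → ℝ) : Prop :=
  ∀ ε : ℝ, 0 < ε → ∃ M : ℝ, 0 < M ∧
    ∀ᶠ m in atTop, Q m {d | ENNReal.ofReal (M * r m) < X m d} ≤ ENNReal.ofReal ε

/-- `N n` grows in probability at least at the rate `a n`, that is, `a n / N n` is stochastically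
bounded: for each `ε > 0` there is `c > 0` such that `N n ≥ c * a n` outside an event of probability
at most `ε`, for all large `n`. -/
def IsOmegap {Ω : Type*} [MeasurableSpace Ω] (μ : Measure Ω) (N : ℕ → Ω → ℕ) (a : ℕ → ℕ) :
    Prop :=
  ∀ ε : ℝ, 0 < ε → ∃ c : ℝ, 0 < c ∧
    ∀ᶠ n in atTop, μ {ω | (N n ω : ℝ) < c * (a n : ℝ)} ≤ ENNReal.ofReal ε

/-- The uniform distance `sup_x |q x - p x|`, with value `∞` if it is unbounded. -/
noncomputable def supDist {S : Type*} (q p : S → ℝ) : ℝ≥0∞ :=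
  ⨆ x, ENNReal.ofReal |q x - p x|

end BAGofT

/-!
Because the split is independent of the i.i.d. observations, the training set and the test set are
jointly distributed as two independent i.i.d. samples (`BAGofT.map_trainingSet_testSet`). The fit
and the groups can therefore be treated as fixed when the test set is integrated out.

Given the training set and the test covariates, the test responses are independent Bernoulli
variables with success probabilities `p (x i)`. This conditioning is made concrete by writing an
observation as `(X, 1{V ≤ p X})` with `V` uniform on `[0, 1]` and independent of `X`
(`BAGofT.map_randomize`). The conditional characteristic function of the group sums
`Z k = ∑ (y - p) / √(∑ p (1 - p))` is then a product of Bernoulli characteristic functions. It is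
close to that of the standard normal law on `ℝ ^ K` as soon as every group variance is large
(`BAGofT.norm_condCharFun_sub_exp_le`). Each group contains a fraction of the test points with
high probability and `p` stays away from `0` and `1`, so Lévy's theorem gives convergence of
`(Z k)` to independent standard normal variables (`BAGofT.tendstoInDistribution_stdSum`).

The statistic uses the fit `q` in place of `p`. In each group its standardized sum equals
`a k * Z k + b k`, where `a k` is a ratio of standard deviations and `b k` is the bias
`∑ (p - q) / √(∑ q (1 - q))`. If `q` is uniformly `ρ`-close to `p`, then `a k - 1 = O(ρ)` and
`b k = O(√n₂ ρ)` (`BAGofT.abs_sqrt_groupVar_div_sub_one_le`, `BAGofT.abs_stdSum_sub_le`). Both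
vanish in probability because `n₂ * r (n₁) ^ 2 → 0`, and Slutsky's theorem concludes
(`BAGofT.tendstoInDistribution_bag`).
-/

namespace BAGofT

/-! ### Characteristic functions of Bernoulli variables -/

/-- The characteristic function, at `s`, of the centred Bernoulli law with success
probability `p`. -/
noncomputable def bernoulliCharFun (p s : ℝ) : ℂ :=
  p * Complex.exp (Complex.I * (s * (1 - p) : ℝ)) +
    (1 - p) * Complex.exp (Complex.I * (s * (0 - p) : ℝ))

theorem norm_cexp_I_mul_ofReal (x : ℝ) : ‖Complex.exp (Complex.I * x)‖ = 1 := by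
  rw [mul_comm, Complex.norm_exp_ofReal_mul_I]

theorem norm_bernoulliCharFun_le_one {p : ℝ} (h0 : 0 ≤ p) (h1 : p ≤ 1) (s : ℝ) :
    ‖bernoulliCharFun p s‖ ≤ 1 := by
  unfold bernoulliCharFun
  refine (norm_add_le _ _).trans ?_
  rw [norm_mul, norm_mul, norm_cexp_I_mul_ofReal, norm_cexp_I_mul_ofReal, ← Complex.ofReal_one,
    ← Complex.ofReal_sub, Complex.norm_real, Complex.norm_real, Real.norm_of_nonneg h0,
    Real.norm_of_nonneg (by linarith)]
  linarith

theorem norm_cexp_I_mul_sub_taylor_le {x : ℝ} (hx : |x| ≤ 1) :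
    ‖Complex.exp (Complex.I * x) - (1 + Complex.I * x - x ^ 2 / 2)‖ ≤ |x| ^ 3 * (2 / 9) := by
  have h := Complex.exp_bound (x := Complex.I * x) (by simpa using hx) (n := 3) (by norm_num)
  simp only [Finset.sum_range_succ, Finset.sum_range_zero, norm_mul, Complex.norm_I, one_mul,
    Complex.norm_real, Real.norm_eq_abs] at h
  refine le_trans (le_of_eq ?_) (h.trans (le_of_eq ?_))
  · congr 2
    simp [mul_pow, Nat.factorial]
    ring
  · norm_num [Nat.factorial]

/-- The second-order Taylor expansions of the two sides agree, because the centred Bernoulli law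
has mean `0` and variance `p * (1 - p)`. -/
theorem norm_bernoulliCharFun_sub_exp_le {p s : ℝ} (h0 : 0 ≤ p) (h1 : p ≤ 1) (hs : |s| ≤ 1) :
    ‖bernoulliCharFun p s - Complex.exp (-(p * (1 - p) * s ^ 2 / 2 : ℝ))‖ ≤ |s| ^ 3 := by
  have ha : |s * (1 - p)| ≤ |s| := by
    rw [abs_mul, abs_of_nonneg (by linarith : 0 ≤ 1 - p)]
    exact mul_le_of_le_one_right (abs_nonneg _) (by linarith)
  have hb : |s * (0 - p)| ≤ |s| := by
    rw [abs_mul, zero_sub, abs_neg, abs_of_nonneg h0]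
    exact mul_le_of_le_one_right (abs_nonneg _) h1
  have h1' := norm_cexp_I_mul_sub_taylor_le (ha.trans hs)
  have h2' := norm_cexp_I_mul_sub_taylor_le (hb.trans hs)
  have hs0 := abs_nonneg s
  have hpq : 0 ≤ p * (1 - p) := mul_nonneg h0 (by linarith)
  have hpq4 : p * (1 - p) ≤ 1 / 4 := by nlinarith [sq_nonneg (p - 1 / 2)]
  set y : ℝ := p * (1 - p) * s ^ 2 / 2 with hy
  have hss : s ^ 2 = |s| ^ 2 := (sq_abs s).symm
  have hy0 : 0 ≤ y := by positivity
  have hy1 : y ≤ |s| ^ 2 / 8 := by rw [hy, hss]; nlinarith [sq_nonneg |s|]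
  have hyle : y ≤ 1 := by nlinarith
  have h3 := Real.exp_bound (x := -y) (by rwa [abs_neg, abs_of_nonneg hy0]) (n := 2) (by norm_num)
  simp only [Finset.sum_range_succ, Finset.sum_range_zero, abs_neg, abs_of_nonneg hy0] at h3
  norm_num [Nat.factorial] at h3
  set A := Complex.exp (Complex.I * (s * (1 - p) : ℝ)) with hA
  set B := Complex.exp (Complex.I * (s * (0 - p) : ℝ)) with hB
  have key : bernoulliCharFun p s - Complex.exp (-(y : ℝ)) =
      (p : ℂ) * (A - (1 + Complex.I * (s * (1 - p) : ℝ) - ((s * (1 - p) : ℝ) : ℂ) ^ 2 / 2)) +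
      ((1 - p : ℝ) : ℂ) *
        (B - (1 + Complex.I * (s * (0 - p) : ℝ) - ((s * (0 - p) : ℝ) : ℂ) ^ 2 / 2)) -
      ((Real.exp (-y) - (1 + -y) : ℝ) : ℂ) := by
    unfold bernoulliCharFun
    rw [← hA, ← hB, hy]
    push_cast
    ring
  rw [key]
  have e1 : ‖(p : ℂ) * (A - (1 + Complex.I * (s * (1 - p) : ℝ)
      - ((s * (1 - p) : ℝ) : ℂ) ^ 2 / 2))‖ ≤ p * (|s| ^ 3 * (2 / 9)) := by
    rw [norm_mul, Complex.norm_real, Real.norm_of_nonneg h0]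
    gcongr
    refine h1'.trans ?_
    gcongr
  have e2 : ‖((1 - p : ℝ) : ℂ) * (B - (1 + Complex.I * (s * (0 - p) : ℝ)
      - ((s * (0 - p) : ℝ) : ℂ) ^ 2 / 2))‖ ≤ (1 - p) * (|s| ^ 3 * (2 / 9)) := by
    have hp' : 0 ≤ 1 - p := by linarith
    rw [norm_mul, Complex.norm_real, Real.norm_of_nonneg hp']
    gcongr
    refine h2'.trans ?_
    gcongr
  have e3 : ‖((Real.exp (-y) - (1 + -y) : ℝ) : ℂ)‖ ≤ |s| ^ 3 * (1 / 9) := by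
    rw [Complex.norm_real, Real.norm_eq_abs]
    refine h3.trans ?_
    have : y ^ 2 ≤ (|s| ^ 2 / 8) ^ 2 := by gcongr
    have h4 : |s| ^ 4 ≤ |s| ^ 3 := pow_le_pow_of_le_one hs0 hs (by norm_num)
    have h5 : 0 ≤ |s| ^ 3 := by positivity
    nlinarith
  refine (norm_sub_le _ _).trans ?_
  refine (add_le_add ((norm_add_le _ _).trans (add_le_add e1 e2)) e3).trans ?_
  have h5 : 0 ≤ |s| ^ 3 := by positivity
  nlinarith

theorem norm_prod_sub_prod_le_sum {ι : Type*} (t : Finset ι) (a b : ι → ℂ)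
    (ha : ∀ i ∈ t, ‖a i‖ ≤ 1) (hb : ∀ i ∈ t, ‖b i‖ ≤ 1) :
    ‖∏ i ∈ t, a i - ∏ i ∈ t, b i‖ ≤ ∑ i ∈ t, ‖a i - b i‖ := by
  classical
  induction t using Finset.induction_on with
  | empty => simp
  | insert j t hj ih =>
    rw [Finset.prod_insert hj, Finset.prod_insert hj, Finset.sum_insert hj]
    have e : a j * ∏ i ∈ t, a i - b j * ∏ i ∈ t, b i =
        (a j - b j) * ∏ i ∈ t, a i + b j * (∏ i ∈ t, a i - ∏ i ∈ t, b i) := by ring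
    have hprod : ‖∏ i ∈ t, a i‖ ≤ 1 := by
      rw [norm_prod]
      exact Finset.prod_le_one (fun i _ => norm_nonneg _)
        fun i hi => ha i (Finset.mem_insert_of_mem hi)
    rw [e]
    refine (norm_add_le _ _).trans (add_le_add ?_ ?_)
    · rw [norm_mul]
      exact mul_le_of_le_one_right (norm_nonneg _) hprod
    · rw [norm_mul]
      refine (mul_le_of_le_one_left (norm_nonneg _) (hb j (Finset.mem_insert_self _ _))).trans ?_
      exact ih (fun i hi => ha i (Finset.mem_insert_of_mem hi))
        fun i hi => hb i (Finset.mem_insert_of_mem hi)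

/-! ### Conditioning on the covariates -/

/-- The uniform law on `[0, 1]`. -/
noncomputable def unif : Measure ℝ := volume.restrict (Set.Icc 0 1)

instance instIsProbabilityMeasureUnif : IsProbabilityMeasure unif :=
  ⟨by simp [unif]⟩

open Classical in
/-- The response `Y = 1{V ≤ p x}` produced at the covariate `x` by a uniform variable `V`. -/
noncomputable def randomize {S : Type*} (p : S → ℝ) (z : S × ℝ) : Obs S :=
  (z.1, decide (z.2 ≤ p z.1))

variable {S : Type*}

theorem measurable_resp : Measurable resp := measurable_from_top

theorem measurable_randomize [MeasurableSpace S] {p : S → ℝ} (hp : Measurable p) :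
    Measurable (randomize p) := by
  refine measurable_fst.prodMk (measurable_to_bool ?_)
  have : (fun z : S × ℝ => decide (z.2 ≤ p z.1)) ⁻¹' {true} = {z | z.2 ≤ p z.1} := by
    ext z; simp
  rw [this]
  exact measurableSet_le measurable_snd (hp.comp measurable_fst)

theorem unif_Iic {a : ℝ} (h1 : a ≤ 1) : unif (Set.Iic a) = ENNReal.ofReal a := by
  rw [unif, Measure.restrict_apply measurableSet_Iic]
  have : Set.Iic a ∩ Set.Icc 0 1 = Set.Icc 0 a := by
    ext x; simp; constructor
    · rintro ⟨h, h', _⟩; exact ⟨h', h⟩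
    · rintro ⟨h, h'⟩; exact ⟨h', h, h'.trans h1⟩
  rw [this]; simp

/-- An observation has the law of `(X, 1{V ≤ p X})` with `V` uniform on `[0, 1]` and independent
of `X`. -/
theorem map_randomize [MeasurableSpace S] (P : Measure (Obs S)) [IsProbabilityMeasure P]
    {p : S → ℝ} (hp : IsRegressionFunction P p) : (P.fst.prod unif).map (randomize p) = P := by
  obtain ⟨hpm, hp01, hpA⟩ := hp
  have hm := measurable_randomize hpm
  have htrue : ∀ A : Set S, MeasurableSet A →
      (P.fst.prod unif).map (randomize p) (A ×ˢ {true}) = P (A ×ˢ {true}) := by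
    intro A hA
    rw [hpA A hA, Measure.map_apply hm (hA.prod (MeasurableSet.singleton _)),
      Measure.prod_apply (hm (hA.prod (MeasurableSet.singleton _))), ← lintegral_indicator hA]
    refine lintegral_congr fun x => ?_
    by_cases hx : x ∈ A
    · rw [Set.indicator_of_mem hx, ← unif_Iic (hp01 x).2]
      congr 1
      ext v
      simp [randomize, hx]
    · rw [Set.indicator_of_notMem hx]
      convert measure_empty (μ := unif)
      ext v
      simp [randomize, hx]
  have : IsProbabilityMeasure ((P.fst.prod unif).map (randomize p)) :=
    Measure.isProbabilityMeasure_map hm.aemeasurable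
  have huniv : ∀ A : Set S, MeasurableSet A →
      (P.fst.prod unif).map (randomize p) (A ×ˢ Set.univ) = P (A ×ˢ Set.univ) := by
    intro A hA
    have e : (A ×ˢ Set.univ : Set (Obs S)) = Prod.fst ⁻¹' A := by ext; simp
    rw [e, Measure.map_apply hm (measurable_fst hA)]
    have : randomize p ⁻¹' (Prod.fst ⁻¹' A) = A ×ˢ (Set.univ : Set ℝ) := by
      ext; simp [randomize]
    rw [this, Measure.prod_prod, measure_univ, mul_one, Measure.fst_apply hA]
  have hfalse : ∀ A : Set S, MeasurableSet A →
      (P.fst.prod unif).map (randomize p) (A ×ˢ {false}) = P (A ×ˢ {false}) := by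
    intro A hA
    have e : (A ×ˢ {false} : Set (Obs S)) = A ×ˢ Set.univ \ A ×ˢ {true} := by
      ext ⟨x, y⟩; cases y <;> simp
    have hsub : (A ×ˢ {true} : Set (Obs S)) ⊆ A ×ˢ Set.univ :=
      Set.prod_mono subset_rfl (Set.subset_univ _)
    rw [e, measure_sdiff hsub (hA.prod (MeasurableSet.singleton true)).nullMeasurableSet
      (measure_ne_top _ _), measure_sdiff hsub
      (hA.prod (MeasurableSet.singleton true)).nullMeasurableSet (measure_ne_top _ _),
      htrue A hA, huniv A hA]
  ext B hB
  have e : B = ((fun x => (x, true)) ⁻¹' B) ×ˢ {true} ∪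
      ((fun x => (x, false)) ⁻¹' B) ×ˢ {false} := by
    ext ⟨x, y⟩; cases y <;> simp
  have m1 : MeasurableSet ((fun x : S => (x, true)) ⁻¹' B) :=
    (measurable_id.prodMk measurable_const) hB
  have m2 : MeasurableSet ((fun x : S => (x, false)) ⁻¹' B) :=
    (measurable_id.prodMk measurable_const) hB
  have hd : Disjoint (((fun x : S => (x, true)) ⁻¹' B) ×ˢ ({true} : Set Bool))
      (((fun x : S => (x, false)) ⁻¹' B) ×ˢ {false}) := by
    rw [Set.disjoint_left]
    rintro ⟨x, y⟩ h h'
    simp at h h'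
    simp [h.2] at h'
  rw [e, measure_union hd (m2.prod (MeasurableSet.singleton _)),
    measure_union hd (m2.prod (MeasurableSet.singleton _)), htrue _ m1, hfalse _ m2]

theorem integral_unif_cexp {p : ℝ} (h0 : 0 ≤ p) (h1 : p ≤ 1) (s : ℝ) :
    ∫ v, Complex.exp (Complex.I * (s * (resp (decide (v ≤ p)) - p) : ℝ)) ∂unif =
      bernoulliCharFun p s := by
  set A := Complex.exp (Complex.I * (s * (1 - p) : ℝ)) with hA
  set B := Complex.exp (Complex.I * (s * (0 - p) : ℝ)) with hB
  have e : (fun v : ℝ => Complex.exp (Complex.I * (s * (resp (decide (v ≤ p)) - p) : ℝ))) =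
      fun v => (Set.Iic p).indicator (fun _ => A) v + (Set.Iic p)ᶜ.indicator (fun _ => B) v := by
    funext v
    by_cases h : v ≤ p
    · simp [h, resp, hA]
    · simp [h, resp, hB, not_le.mp h]
  have hr : unif.real (Set.Iic p) = p := by
    rw [Measure.real, unif_Iic h1, ENNReal.toReal_ofReal h0]
  rw [e, integral_add ((integrable_const A).indicator measurableSet_Iic)
    ((integrable_const B).indicator measurableSet_Iic.compl),
    integral_indicator measurableSet_Iic, integral_indicator measurableSet_Iic.compl,
    setIntegral_const, setIntegral_const, probReal_compl_eq_one_sub measurableSet_Iic, hr]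
  simp [bernoulliCharFun, hA, hB]

/-- Given the covariates, the responses are independent Bernoulli variables. Conditionally on the
covariates, the integral of the exponential is thus a product of characteristic functions. -/
theorem integral_pi_cexp [MeasurableSpace S] (P : Measure (Obs S)) [IsProbabilityMeasure P]
    {p : S → ℝ} (hp : IsRegressionFunction P p) {m : ℕ} (c : (Fin m → S) → Fin m → ℝ)
    (hc : Measurable c) :
    ∫ t, Complex.exp (Complex.I *
        (∑ i, c (fun j => (t j).1) i * (resp (t i).2 - p (t i).1) : ℝ))
          ∂Measure.pi (fun _ : Fin m => P) =
      ∫ t, ∏ i, bernoulliCharFun (p (t i).1) (c (fun j => (t j).1) i)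
        ∂Measure.pi (fun _ : Fin m => P) := by
  have hpm := hp.1
  have hm := measurable_randomize hpm
  have hci : ∀ i, Measurable fun x : Fin m → S => c x i := fun i => (measurable_pi_apply i).comp hc
  have hfst : Measurable fun t : Fin m → Obs S => fun j => (t j).1 := by fun_prop
  have hmL : Measurable fun t : Fin m → Obs S => Complex.exp (Complex.I *
      (∑ i, c (fun j => (t j).1) i * (resp (t i).2 - p (t i).1) : ℝ)) := by
    refine Complex.measurable_exp.comp (measurable_const.mul (Complex.measurable_ofReal.comp ?_))
    refine Finset.measurable_sum _ fun i _ => ((hci i).comp hfst).mul ?_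
    exact (measurable_resp.comp (measurable_snd.comp (measurable_pi_apply i))).sub
      (hpm.comp (measurable_fst.comp (measurable_pi_apply i)))
  have hmR : Measurable fun t : Fin m → Obs S =>
      ∏ i, bernoulliCharFun (p (t i).1) (c (fun j => (t j).1) i) := by
    have h1 : ∀ i, Measurable fun t : Fin m → Obs S => p (t i).1 := fun i =>
      hpm.comp (measurable_fst.comp (measurable_pi_apply i))
    have h2 : ∀ i, Measurable fun t : Fin m → Obs S => c (fun j => (t j).1) i := fun i =>
      (hci i).comp hfst
    unfold bernoulliCharFun
    fun_prop
  have hlaw : Measure.pi (fun _ : Fin m => P) =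
      (Measure.pi fun _ : Fin m => P.fst.prod unif).map fun z i => randomize p (z i) := by
    rw [Measure.pi_map_pi (fun _ => hm.aemeasurable)]
    simp_rw [map_randomize P hp]
  have hpi : Measurable fun (z : Fin m → S × ℝ) i => randomize p (z i) :=
    measurable_pi_lambda _ fun i => hm.comp (measurable_pi_apply i)
  have hmp := measurePreserving_arrowProdEquivProdArrow S ℝ (Fin m)
    (fun _ => P.fst) (fun _ => unif)
  rw [hlaw, integral_map hpi.aemeasurable hmL.aestronglyMeasurable,
    integral_map hpi.aemeasurable hmR.aestronglyMeasurable,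
    ← hmp.symm.integral_comp', ← hmp.symm.integral_comp', integral_prod, integral_prod]
  · refine integral_congr_ae (.of_forall fun x => ?_)
    have e1 : ∀ v : Fin m → ℝ, Complex.exp (Complex.I * (∑ i, c x i *
        (resp (decide (v i ≤ p (x i))) - p (x i)) : ℝ)) = ∏ i, Complex.exp (Complex.I *
          (c x i * (resp (decide (v i ≤ p (x i))) - p (x i)) : ℝ)) := by
      intro v
      rw [← Complex.exp_sum, ← Finset.mul_sum, Complex.ofReal_sum]
    have e2 := integral_fintype_prod_eq_prod (𝕜 := ℂ) (μ := fun _ : Fin m => unif)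
      (fun i v => Complex.exp (Complex.I *
          (c x i * (resp (decide (v ≤ p (x i))) - p (x i)) : ℝ)))
    simp only [integral_unif_cexp (hp.2.1 _).1 (hp.2.1 _).2] at e2
    simp only [← e1] at e2
    refine Eq.trans ?_ (e2.trans ?_)
    · rfl
    · simp [randomize, MeasurableEquiv.arrowProdEquivProdArrow, Equiv.arrowProdEquivProdArrow]
  · refine Integrable.of_bound (C := 1)
      ((hmR.comp (hpi.comp (MeasurableEquiv.measurable _))).aestronglyMeasurable) ?_
    refine .of_forall fun z => ?_
    rw [norm_prod]
    exact Finset.prod_le_one (fun i _ => norm_nonneg _)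
      fun i _ => norm_bernoulliCharFun_le_one (hp.2.1 _).1 (hp.2.1 _).2 _
  · refine Integrable.of_bound (C := 1)
      ((hmL.comp (hpi.comp (MeasurableEquiv.measurable _))).aestronglyMeasurable) ?_
    exact .of_forall fun z => (norm_cexp_I_mul_ofReal _).le

/-! ### The joint law of the training set and the test set -/

/-- For a fixed split this is the independence of disjoint blocks of observations, and the common
law does not depend on the split. -/
theorem map_trainingSet_testSet [MeasurableSpace S] (P : Measure (Obs S)) [IsProbabilityMeasure P]
    {Ω : Type*} [MeasurableSpace Ω] (μ : Measure Ω) [IsProbabilityMeasure μ]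
    (D : Ω → ℕ → Obs S) (hD_meas : ∀ i, Measurable fun ω => D ω i)
    (hD_law : ∀ i, μ.map (fun ω => D ω i) = P) (hD_indep : iIndepFun (fun i ω => D ω i) μ)
    {m₁ m₂ n : ℕ} (split : Ω → Split m₁ m₂ n) (hsplit : Measurable split)
    (hindep : IndepFun split D μ) :
    Measurable (fun ω => (trainingSet (D ω) (split ω), testSet (D ω) (split ω))) ∧
    μ.map (fun ω => (trainingSet (D ω) (split ω), testSet (D ω) (split ω))) =
      (Measure.pi fun _ : Fin m₁ => P).prod (Measure.pi fun _ : Fin m₂ => P) := by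
  have hDm : Measurable D := measurable_pi_lambda _ hD_meas
  let g : Split m₁ m₂ n × (ℕ → Obs S) → (Fin m₁ → Obs S) × (Fin m₂ → Obs S) :=
    fun z => (trainingSet z.2 z.1, testSet z.2 z.1)
  have hgs : ∀ s, Measurable fun D : ℕ → Obs S => g (s, D) := by
    intro s
    refine Measurable.prodMk ?_ ?_
    · exact measurable_pi_lambda _ fun i => measurable_pi_apply (s (Sum.inl i) : ℕ)
    · exact measurable_pi_lambda _ fun i => measurable_pi_apply (s (Sum.inr i) : ℕ)
  have hg : Measurable g := measurable_from_prod_countable_right hgs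
  have hpair : Measurable fun ω => (split ω, D ω) := hsplit.prodMk hDm
  refine ⟨hg.comp hpair, ?_⟩
  have hlaw : ∀ s : Split m₁ m₂ n, (μ.map D).map (fun D => g (s, D)) =
      (Measure.pi fun _ : Fin m₁ => P).prod (Measure.pi fun _ : Fin m₂ => P) := by
    intro s
    have hinj : Function.Injective fun j : Fin m₁ ⊕ Fin m₂ => ((s j : Fin n) : ℕ) :=
      Fin.val_injective.comp s.injective
    have h1 := hD_indep.precomp hinj
    have h2 := (iIndepFun_iff_map_fun_eq_pi_map (μ := μ)
      (f := fun (j : Fin m₁ ⊕ Fin m₂) ω => D ω (s j)) (fun j => (hD_meas _).aemeasurable)).1 h1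
    simp only [hD_law] at h2
    have h3 := (measurePreserving_sumPiEquivProdPi
      (X := fun _ : Fin m₁ ⊕ Fin m₂ => Obs S) (fun _ => P)).map_eq
    rw [← h3, ← h2, Measure.map_map (hgs s) hDm, Measure.map_map (MeasurableEquiv.measurable _)
      (measurable_pi_lambda _ fun j => hD_meas _)]
    rfl
  have hprod := (indepFun_iff_map_prod_eq_prod_map_map hsplit.aemeasurable
    hDm.aemeasurable).1 hindep
  have : IsProbabilityMeasure (μ.map split) := Measure.isProbabilityMeasure_map hsplit.aemeasurable
  have : IsProbabilityMeasure (μ.map D) := Measure.isProbabilityMeasure_map hDm.aemeasurable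
  have e : (fun ω => (trainingSet (D ω) (split ω), testSet (D ω) (split ω))) =
      g ∘ fun ω => (split ω, D ω) := rfl
  rw [e, ← Measure.map_map hg hpair, hprod]
  ext A hA
  rw [Measure.map_apply hg hA, Measure.prod_apply (hg hA)]
  have : ∀ s, (μ.map D) (Prod.mk s ⁻¹' (g ⁻¹' A)) =
      ((Measure.pi fun _ : Fin m₁ => P).prod (Measure.pi fun _ : Fin m₂ => P)) A := by
    intro s
    rw [← hlaw s, Measure.map_apply (hgs s) hA]
    rfl
  simp [this]

/-! ### Standardized group sums -/

/-- The variance `∑ q (1 - q)` that the probability function `q` assigns to the sum of the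
responses of the test points in the group `A`. -/
noncomputable def groupVar (q : S → ℝ) {m : ℕ} (A : Set S) (t : Fin m → Obs S) : ℝ :=
  ∑ i ∈ members t A, q (t i).1 * (1 - q (t i).1)

/-- The sum of the residuals in the group `A` divided by the standard deviation computed
from `q`. -/
noncomputable def stdSum (q : S → ℝ) {m : ℕ} (A : Set S) (t : Fin m → Obs S) : ℝ :=
  (∑ i ∈ members t A, (resp (t i).2 - q (t i).1)) / √(groupVar q A t)

theorem bag_eq_sum_stdSum {K m : ℕ} (q : S → ℝ) (G : Fin K → Set S) (t : Fin m → Obs S) :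
    bag q G t = ∑ k, stdSum q (G k) t ^ 2 := rfl

open Classical in
/-- The coefficient of the `i`-th residual in the linear combination `∑ k, u k * Z k` of the
standardized group sums `Z k`, as a function of the covariates `x`. -/
noncomputable def residualCoef (p : S → ℝ) {K m : ℕ} (G : Fin K → Set S) (u : Fin K → ℝ)
    (x : Fin m → S) (i : Fin m) : ℝ :=
  ∑ k, if x i ∈ G k then u k / √(∑ j, if x j ∈ G k then p (x j) * (1 - p (x j)) else 0) else 0

theorem residualCoef_eq (p : S → ℝ) {K m : ℕ} {G : Fin K → Set S} (hG : IsPartition G)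
    (u : Fin K → ℝ) (t : Fin m → Obs S) {i : Fin m} {k : Fin K} (hik : (t i).1 ∈ G k) :
    residualCoef p G u (fun j => (t j).1) i = u k / √(groupVar p (G k) t) := by
  classical
  rw [residualCoef, Finset.sum_eq_single k]
  · rw [if_pos hik, groupVar, members, Finset.sum_filter]
  · intro l _ hl
    rw [if_neg fun hil => Set.disjoint_left.1 (hG.1 hl) hil hik]
  · simp

theorem sum_groups {K m : ℕ} {G : Fin K → Set S} (hG : IsPartition G)
    (t : Fin m → Obs S) (f : Fin m → ℝ) : ∑ k, ∑ i ∈ members t (G k), f i = ∑ i, f i := by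
  classical
  simp only [members, Finset.sum_filter]
  rw [Finset.sum_comm]
  refine Finset.sum_congr rfl fun i _ => ?_
  obtain ⟨k, hk⟩ := Set.mem_iUnion.1 (hG.2 ▸ Set.mem_univ (t i).1)
  rw [Finset.sum_eq_single k]
  · rw [if_pos hk]
  · intro l _ hl
    rw [if_neg fun hil => Set.disjoint_left.1 (hG.1 hl) hil hk]
  · simp

theorem mem_members {m : ℕ} {t : Fin m → Obs S} {A : Set S} {i : Fin m} :
    i ∈ members t A ↔ (t i).1 ∈ A := by
  classical
  simp [members]

theorem sum_mul_stdSum (p : S → ℝ) {K m : ℕ} {G : Fin K → Set S} (hG : IsPartition G)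
    (u : Fin K → ℝ) (t : Fin m → Obs S) :
    ∑ k, u k * stdSum p (G k) t =
      ∑ i, residualCoef p G u (fun j => (t j).1) i * (resp (t i).2 - p (t i).1) := by
  rw [← sum_groups hG t]
  refine Finset.sum_congr rfl fun k _ => ?_
  rw [stdSum, mul_div_left_comm, mul_comm, Finset.mul_sum]
  exact Finset.sum_congr rfl fun i hi => by rw [residualCoef_eq p hG u t (mem_members.1 hi)]

/-- The conditional characteristic function, at `u`, of the standardized group sums given the
covariates. -/
noncomputable def condCharFun (p : S → ℝ) {K m : ℕ} (G : Fin K → Set S) (u : Fin K → ℝ)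
    (t : Fin m → Obs S) : ℂ :=
  ∏ i, bernoulliCharFun (p (t i).1) (residualCoef p G u (fun j => (t j).1) i)

theorem norm_condCharFun_le_one {p : S → ℝ} (hp : ∀ x, 0 ≤ p x ∧ p x ≤ 1) {K m : ℕ}
    (G : Fin K → Set S) (u : Fin K → ℝ) (t : Fin m → Obs S) : ‖condCharFun p G u t‖ ≤ 1 := by
  rw [condCharFun, norm_prod]
  exact Finset.prod_le_one (fun i _ => norm_nonneg _)
    fun i _ => norm_bernoulliCharFun_le_one (hp _).1 (hp _).2 _

/-- A Lindeberg-type bound: each coefficient is at most `δ`, and the coefficients weighted by the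
variances have sum of squares `∑ k, u k ^ 2`. -/
theorem norm_condCharFun_sub_exp_le {p : S → ℝ} (hp : ∀ x, 0 ≤ p x ∧ p x ≤ 1) {K m : ℕ}
    {G : Fin K → Set S} (hG : IsPartition G) (u : Fin K → ℝ) (t : Fin m → Obs S)
    {c δ : ℝ} (hc : 0 < c) (hδ0 : 0 ≤ δ) (hδ1 : δ ≤ 1)
    (hpc : ∀ i, c ≤ p (t i).1 * (1 - p (t i).1))
    (hV : ∀ k, 0 < groupVar p (G k) t) (hu : ∀ k, |u k| ≤ δ * √(groupVar p (G k) t)) :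
    ‖condCharFun p G u t - Complex.exp (-((∑ k, u k ^ 2) / 2 : ℝ))‖ ≤
      δ / c * ∑ k, u k ^ 2 := by
  set s := residualCoef p G u (fun j => (t j).1) with hs
  have hsδ : ∀ i, |s i| ≤ δ := by
    intro i
    obtain ⟨k, hk⟩ := Set.mem_iUnion.1 (hG.2 ▸ Set.mem_univ (t i).1)
    have hpos := Real.sqrt_pos.2 (hV k)
    rw [hs, residualCoef_eq p hG u t hk, abs_div, abs_of_pos hpos, div_le_iff₀ hpos]
    exact hu k
  have hsum : ∑ i, p (t i).1 * (1 - p (t i).1) * s i ^ 2 = ∑ k, u k ^ 2 := by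
    rw [← sum_groups hG t]
    refine Finset.sum_congr rfl fun k _ => ?_
    calc ∑ i ∈ members t (G k), p (t i).1 * (1 - p (t i).1) * s i ^ 2
        = ∑ i ∈ members t (G k), p (t i).1 * (1 - p (t i).1) * (u k ^ 2 / groupVar p (G k) t) := by
          refine Finset.sum_congr rfl fun i hi => ?_
          rw [hs, residualCoef_eq p hG u t (mem_members.1 hi), div_pow, Real.sq_sqrt (hV k).le]
      _ = u k ^ 2 := by
          rw [← Finset.sum_mul, ← groupVar]
          field_simp [(hV k).ne']
  have hexp : Complex.exp (-((∑ k, u k ^ 2) / 2 : ℝ)) =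
      ∏ i, Complex.exp (-(p (t i).1 * (1 - p (t i).1) * s i ^ 2 / 2 : ℝ)) := by
    rw [← Complex.exp_sum, ← hsum, Finset.sum_div, Finset.sum_neg_distrib, Complex.ofReal_sum]
  rw [hexp, condCharFun]
  refine (norm_prod_sub_prod_le_sum _ _ _
    (fun i _ => norm_bernoulliCharFun_le_one (hp _).1 (hp _).2 _) fun i _ => ?_).trans ?_
  · rw [← Complex.ofReal_neg, Complex.norm_exp_ofReal, Real.exp_le_one_iff]
    have := (hp (t i).1).1
    have h2 : 0 ≤ 1 - p (t i).1 := by linarith [(hp (t i).1).2]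
    have : 0 ≤ p (t i).1 * (1 - p (t i).1) * s i ^ 2 := by positivity
    linarith
  · rw [← hsum, Finset.mul_sum]
    refine Finset.sum_le_sum fun i _ => ?_
    refine (norm_bernoulliCharFun_sub_exp_le (hp _).1 (hp _).2 ((hsδ i).trans hδ1)).trans ?_
    calc |s i| ^ 3 = |s i| * s i ^ 2 := by rw [← sq_abs]; ring
      _ ≤ δ * s i ^ 2 := by gcongr; exact hsδ i
      _ = δ / c * (c * s i ^ 2) := by field_simp
      _ ≤ _ := by gcongr; exact hpc i

theorem mul_card_le_groupVar {p : S → ℝ} {m : ℕ} {t : Fin m → Obs S} {c : ℝ}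
    (hpc : ∀ i, c ≤ p (t i).1 * (1 - p (t i).1)) (A : Set S) :
    c * (members t A).card ≤ groupVar p A t := by
  rw [groupVar, mul_comm, ← nsmul_eq_mul]
  exact Finset.card_nsmul_le_sum _ _ _ fun i _ => hpc i

/-- If `q` is uniformly `ρ`-close to `p`, then the standard deviations computed from `p` and `q`
agree up to a factor `1 + O(ρ)`. -/
theorem abs_sqrt_groupVar_div_sub_one_le {p q : S → ℝ} (hp : ∀ x, 0 ≤ p x ∧ p x ≤ 1) {m : ℕ}
    {t : Fin m → Obs S} {c ρ : ℝ} (hc : 0 < c)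
    (hpc : ∀ i, c ≤ p (t i).1 * (1 - p (t i).1)) (hρ0 : 0 ≤ ρ) (hρ1 : ρ ≤ 1)
    (hρc : ρ ≤ c / 4) (hq : ∀ x, |q x - p x| ≤ ρ) {A : Set S}
    (hN : 0 < (members t A).card) :
    groupVar p A t / 2 ≤ groupVar q A t ∧
    |√(groupVar p A t) / √(groupVar q A t) - 1| ≤ 4 * ρ / c := by
  set N : ℝ := ((members t A).card : ℝ) with hNdef
  have hN' : 0 < N := Nat.cast_pos.2 hN
  set V := groupVar p A t
  set W := groupVar q A t
  have hcN : c * N ≤ V := mul_card_le_groupVar hpc A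
  have hVpos : 0 < V := lt_of_lt_of_le (by positivity) hcN
  have hVW : |V - W| ≤ 2 * ρ * N := by
    calc |V - W| = |∑ i ∈ members t A, (p (t i).1 * (1 - p (t i).1) -
          q (t i).1 * (1 - q (t i).1))| := by rw [Finset.sum_sub_distrib]; rfl
      _ ≤ ∑ i ∈ members t A, 2 * ρ := by
        refine (Finset.abs_sum_le_sum_abs _ _).trans (Finset.sum_le_sum fun i _ => ?_)
        set a := p (t i).1
        set b := q (t i).1
        have hab : |b - a| ≤ ρ := hq _
        have ha := hp (t i).1
        have e : a * (1 - a) - b * (1 - b) = (b - a) * (a + b - 1) := by ring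
        have h2 : |a + b - 1| ≤ 2 := by
          rw [abs_le] at hab ⊢
          constructor <;> linarith [ha.1, ha.2, hab.1, hab.2]
        rw [e, abs_mul, mul_comm 2 ρ]
        gcongr
      _ = 2 * ρ * N := by rw [Finset.sum_const, nsmul_eq_mul, mul_comm]
  have hVW' : |V - W| ≤ 2 * ρ / c * V := by
    refine hVW.trans ?_
    calc 2 * ρ * N = 2 * ρ / c * (c * N) := by field_simp
      _ ≤ _ := by gcongr
  have hhalf : 2 * ρ / c ≤ 1 / 2 := by rw [div_le_iff₀ hc]; linarith
  have hW : V / 2 ≤ W := by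
    have h1 := (abs_le.1 hVW').2
    nlinarith
  refine ⟨hW, ?_⟩
  have hWpos : 0 < W := by linarith
  have hsW := Real.sqrt_pos.2 hWpos
  have hsV := Real.sqrt_pos.2 hVpos
  have e : √V / √W - 1 = (V - W) / (√W * (√V + √W)) := by
    rw [div_sub_one hsW.ne', div_eq_div_iff hsW.ne' (by positivity)]
    nlinarith [Real.sq_sqrt hVpos.le, Real.sq_sqrt hWpos.le]
  rw [e, abs_div, abs_of_pos (by positivity : 0 < √W * (√V + √W)), div_le_iff₀ (by positivity)]
  refine hVW'.trans ?_
  have h3 : W ≤ √W * (√V + √W) := by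
    nlinarith [Real.mul_self_sqrt hWpos.le, mul_pos hsW hsV]
  calc 2 * ρ / c * V ≤ 2 * ρ / c * (2 * W) := by gcongr; linarith
    _ = 4 * ρ / c * W := by ring
    _ ≤ _ := by gcongr

/-- The bias `∑ (p - q)` of the residuals is of order `ρ √m` relative to the standard deviation. -/
theorem abs_stdSum_sub_le {p q : S → ℝ} {m : ℕ}
    {t : Fin m → Obs S} {c ρ : ℝ} (hc : 0 < c)
    (hpc : ∀ i, c ≤ p (t i).1 * (1 - p (t i).1)) (hρ0 : 0 ≤ ρ)
    (hq : ∀ x, |q x - p x| ≤ ρ) {A : Set S}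
    (hN : 0 < (members t A).card) (hW : groupVar p A t / 2 ≤ groupVar q A t) :
    |stdSum q A t - stdSum p A t * (√(groupVar p A t) / √(groupVar q A t))| ≤
      √(2 / c) * (√m * ρ) := by
  set N : ℝ := ((members t A).card : ℝ) with hNdef
  have hN' : 0 < N := Nat.cast_pos.2 hN
  have hNm : N ≤ m := by
    have := Finset.card_le_univ (members t A)
    rw [Fintype.card_fin] at this
    exact Nat.cast_le.2 this
  have hcN : c * N ≤ groupVar p A t := mul_card_le_groupVar hpc A
  have hVpos : 0 < groupVar p A t := lt_of_lt_of_le (by positivity) hcN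
  have hWpos : 0 < groupVar q A t := by linarith
  have hsW := Real.sqrt_pos.2 hWpos
  have hsV := Real.sqrt_pos.2 hVpos
  have e : stdSum q A t - stdSum p A t * (√(groupVar p A t) / √(groupVar q A t)) =
      (∑ i ∈ members t A, (p (t i).1 - q (t i).1)) / √(groupVar q A t) := by
    rw [stdSum, stdSum, div_mul_div_cancel₀ hsV.ne', ← sub_div, ← Finset.sum_sub_distrib]
    congr 1
    exact Finset.sum_congr rfl fun i _ => by ring
  have hnum : |∑ i ∈ members t A, (p (t i).1 - q (t i).1)| ≤ N * ρ := by
    refine (Finset.abs_sum_le_sum_abs _ _).trans ?_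
    rw [← nsmul_eq_mul]
    exact Finset.sum_le_card_nsmul _ _ _ fun i _ => by rw [abs_sub_comm]; exact hq _
  rw [e, abs_div, abs_of_pos hsW, div_le_iff₀ hsW]
  refine hnum.trans ?_
  have h1 : √(c * N / 2) ≤ √(groupVar q A t) := Real.sqrt_le_sqrt (by linarith)
  calc N * ρ = √(2 / c) * (√N * ρ) * √(c * N / 2) := by
        have : √(2 / c) * √(c * N / 2) = √N := by
          rw [← Real.sqrt_mul (by positivity)]; congr 1; field_simp
        calc N * ρ = √N * √N * ρ := by rw [Real.mul_self_sqrt hN'.le]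
          _ = √(2 / c) * √(c * N / 2) * √N * ρ := by rw [this]
          _ = _ := by ring
    _ ≤ _ := by gcongr

/-! ### Measurability -/

theorem measurable_sum_members [MeasurableSpace S] {E : Type*} [MeasurableSpace E] {m : ℕ}
    {A : E → Set S} (hA : MeasurableSet {z : E × S | z.2 ∈ A z.1}) {f : E → Obs S → ℝ}
    (hf : Measurable fun z : E × Obs S => f z.1 z.2) :
    Measurable fun z : E × (Fin m → Obs S) => ∑ i ∈ members z.2 (A z.1), f z.1 (z.2 i) := by
  classical
  simp only [members, Finset.sum_filter]
  refine Finset.measurable_sum _ fun i _ => Measurable.ite ?_ ?_ measurable_const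
  · have : Measurable fun z : E × (Fin m → Obs S) => (z.1, (z.2 i).1) := by fun_prop
    exact this hA
  · have : Measurable fun z : E × (Fin m → Obs S) => (z.1, z.2 i) := by fun_prop
    exact hf.comp this

theorem measurable_groupVar [MeasurableSpace S] {E : Type*} [MeasurableSpace E] {m : ℕ}
    {A : E → Set S} (hA : MeasurableSet {z : E × S | z.2 ∈ A z.1}) {q : E → S → ℝ}
    (hq : Measurable fun z : E × S => q z.1 z.2) :
    Measurable fun z : E × (Fin m → Obs S) => groupVar (q z.1) (A z.1) z.2 := by
  have h : Measurable fun z : E × Obs S => q z.1 z.2.1 :=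
    hq.comp (measurable_fst.prodMk (measurable_fst.comp measurable_snd))
  exact measurable_sum_members hA (f := fun d o => q d o.1 * (1 - q d o.1))
    (h.mul (measurable_const.sub h))

theorem measurable_stdSum [MeasurableSpace S] {E : Type*} [MeasurableSpace E] {m : ℕ}
    {A : E → Set S} (hA : MeasurableSet {z : E × S | z.2 ∈ A z.1}) {q : E → S → ℝ}
    (hq : Measurable fun z : E × S => q z.1 z.2) :
    Measurable fun z : E × (Fin m → Obs S) => stdSum (q z.1) (A z.1) z.2 := by
  have h : Measurable fun z : E × Obs S => q z.1 z.2.1 :=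
    hq.comp (measurable_fst.prodMk (measurable_fst.comp measurable_snd))
  have hr : Measurable fun z : E × Obs S => resp z.2.2 :=
    measurable_resp.comp (measurable_snd.comp measurable_snd)
  exact (measurable_sum_members hA (f := fun d o => resp o.2 - q d o.1) (hr.sub h)).div
    (measurable_groupVar hA hq).sqrt

theorem measurable_residualCoef [MeasurableSpace S] {E : Type*} [MeasurableSpace E] {K m : ℕ}
    {G : E → Fin K → Set S} (hG : ∀ k, MeasurableSet {z : E × S | z.2 ∈ G z.1 k})
    {p : S → ℝ} (hp : Measurable p) (u : Fin K → ℝ) :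
    Measurable fun z : E × (Fin m → S) => residualCoef p (G z.1) u z.2 := by
  classical
  have hmem : ∀ (k : Fin K) (i : Fin m),
      MeasurableSet {z : E × (Fin m → S) | z.2 i ∈ G z.1 k} := fun k i => by
    have : Measurable fun z : E × (Fin m → S) => (z.1, z.2 i) := by fun_prop
    exact this (hG k)
  have hpi : ∀ j : Fin m, Measurable fun z : E × (Fin m → S) => p (z.2 j) := fun j =>
    hp.comp ((measurable_pi_apply j).comp measurable_snd)
  refine measurable_pi_lambda _ fun i => Finset.measurable_sum _ fun k _ =>
    Measurable.ite (hmem k i) (measurable_const.div (Measurable.sqrt ?_)) measurable_const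
  exact Finset.measurable_sum _ fun j _ => Measurable.ite (hmem k j)
    ((hpi j).mul (measurable_const.sub (hpi j))) measurable_const

theorem measurable_condCharFun [MeasurableSpace S] {E : Type*} [MeasurableSpace E] {K m : ℕ}
    {G : E → Fin K → Set S} (hG : ∀ k, MeasurableSet {z : E × S | z.2 ∈ G z.1 k})
    {p : S → ℝ} (hp : Measurable p) (u : Fin K → ℝ) :
    Measurable fun z : E × (Fin m → Obs S) => condCharFun p (G z.1) u z.2 := by
  have h1 : ∀ i, Measurable fun z : E × (Fin m → Obs S) => p (z.2 i).1 := fun i =>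
    hp.comp (measurable_fst.comp ((measurable_pi_apply i).comp measurable_snd))
  have h2 : ∀ i, Measurable fun z : E × (Fin m → Obs S) =>
      residualCoef p (G z.1) u (fun j => (z.2 j).1) i := fun i => by
    have h : Measurable fun z : E × (Fin m → Obs S) => (z.1, fun j => (z.2 j).1) := by fun_prop
    exact (measurable_pi_apply i).comp ((measurable_residualCoef hG hp u).comp h)
  unfold condCharFun bernoulliCharFun
  fun_prop

/-- The characteristic function of the standardized group sums is the expectation of the
conditional one. -/
theorem integral_cexp_stdSum [MeasurableSpace S] (P : Measure (Obs S)) [IsProbabilityMeasure P]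
    {p : S → ℝ} (hp : IsRegressionFunction P p)
    {Ω E : Type*} [MeasurableSpace Ω] [MeasurableSpace E] {μ : Measure Ω}
    {ν : Measure E} [IsProbabilityMeasure ν] {K m : ℕ}
    {d : Ω → E} {t : Ω → Fin m → Obs S} (hdt : Measurable fun ω => (d ω, t ω))
    (hlaw : μ.map (fun ω => (d ω, t ω)) = ν.prod (Measure.pi fun _ => P))
    {G : E → Fin K → Set S} (hG_part : ∀ e, IsPartition (G e))
    (hG : ∀ k, MeasurableSet {z : E × S | z.2 ∈ G z.1 k}) (u : Fin K → ℝ) :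
    ∫ ω, Complex.exp (Complex.I * (∑ k, u k * stdSum p (G (d ω) k) (t ω) : ℝ)) ∂μ =
      ∫ ω, condCharFun p (G (d ω)) u (t ω) ∂μ := by
  have hL : Measurable fun z : E × (Fin m → Obs S) =>
      Complex.exp (Complex.I * (∑ k, u k * stdSum p (G z.1 k) z.2 : ℝ)) := by
    refine Complex.measurable_exp.comp (measurable_const.mul (Complex.measurable_ofReal.comp ?_))
    refine Finset.measurable_sum _ fun k _ => measurable_const.mul ?_
    exact measurable_stdSum (A := fun e => G e k) (hG k) (q := fun _ => p)
      (hp.1.comp measurable_snd)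
  have hR := measurable_condCharFun (m := m) hG hp.1 u
  have hL' := integral_map (μ := μ) hdt.aemeasurable hL.aestronglyMeasurable
  have hR' := integral_map (μ := μ) hdt.aemeasurable hR.aestronglyMeasurable
  rw [← hL', ← hR', hlaw, integral_prod, integral_prod]
  · refine integral_congr_ae (.of_forall fun e => ?_)
    have hc : Measurable fun x : Fin m → S => residualCoef p (G e) u x :=
      (measurable_residualCoef hG hp.1 u).comp measurable_prodMk_left
    simpa only [sum_mul_stdSum p (hG_part e) u, condCharFun] using
      integral_pi_cexp P hp (fun x => residualCoef p (G e) u x) hc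
  · exact Integrable.of_bound (C := 1) hR.aestronglyMeasurable
      (.of_forall fun z => norm_condCharFun_le_one hp.2.1 _ _ _)
  · exact Integrable.of_bound (C := 1) hL.aestronglyMeasurable
      (.of_forall fun z => (norm_cexp_I_mul_ofReal _).le)

/-! ### Asymptotics -/

/-- The favourable event on which all estimates are deterministic: the Bernoulli variances at the
test points are at least `c`, each group contains at least the fraction `κ` of the test points, and
the fit is uniformly `ρ`-close to the true probability function. -/
def IsRegular (p q : S → ℝ) {K m : ℕ} (G : Fin K → Set S) (t : Fin m → Obs S) (c κ ρ : ℝ) :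
    Prop :=
  (∀ i, c ≤ p (t i).1 * (1 - p (t i).1)) ∧ (∀ k, κ * m ≤ (members t (G k)).card) ∧
    ∀ x, |q x - p x| ≤ ρ

theorem norm_integral_le_of_measure_le {Ω : Type*} [MeasurableSpace Ω] {μ : Measure Ω}
    [IsProbabilityMeasure μ] {f : Ω → ℂ} {η ε : ℝ} (hη : 0 ≤ η) (hε : 0 ≤ ε) {B : Set Ω}
    (hf : ∀ ω, ‖f ω‖ ≤ 2) (hB : μ B ≤ ENNReal.ofReal ε) (hfB : ∀ ω ∉ B, ‖f ω‖ ≤ η) :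
    ‖∫ ω, f ω ∂μ‖ ≤ η + 2 * ε := by
  -- `B` need not be measurable, so the bound is integrated over a measurable hull.
  set T := toMeasurable μ B
  have hT : MeasurableSet T := measurableSet_toMeasurable μ B
  have hint : Integrable (fun ω => η + T.indicator (fun _ => (2 : ℝ)) ω) μ :=
    (integrable_const _).add ((integrable_const _).indicator hT)
  have hμT : μ.real T ≤ ε := by
    rw [Measure.real, measure_toMeasurable]
    exact ENNReal.toReal_le_of_le_ofReal hε hB
  refine (norm_integral_le_of_norm_le hint (.of_forall fun ω => ?_)).trans ?_
  · by_cases h : ω ∈ T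
    · rw [Set.indicator_of_mem h]
      linarith [hf ω]
    · rw [Set.indicator_of_notMem h, add_zero]
      exact hfB ω fun hb => h (subset_toMeasurable μ B hb)
  · rw [integral_add (integrable_const _) ((integrable_const _).indicator hT),
      integral_indicator hT, setIntegral_const]
    simp
    linarith

/-- The ratios `a k` of the standard deviations computed from `p` and from `q`, and the biases `b k`
that make `stdSum q = a * stdSum p + b` hold in each group. This identity is exact even if a
standard deviation vanishes. -/
noncomputable def ratioBias (p q : S → ℝ) {K m : ℕ} (G : Fin K → Set S) (t : Fin m → Obs S) :
    (Fin K → ℝ) × (Fin K → ℝ) :=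
  (fun k => √(groupVar p (G k) t) / √(groupVar q (G k) t),
    fun k => stdSum q (G k) t -
      stdSum p (G k) t * (√(groupVar p (G k) t) / √(groupVar q (G k) t)))

/-- The function of `(z, (a, b))` that gives the BAGofT statistic in terms of the sums `z`
standardized with the true probability function, the ratios `a` and the biases `b`. -/
noncomputable def sumSqAffine {K : ℕ}
    (w : EuclideanSpace ℝ (Fin K) × ((Fin K → ℝ) × (Fin K → ℝ))) : ℝ :=
  ∑ k, (w.1 k * w.2.1 k + w.2.2 k) ^ 2

theorem continuous_sumSqAffine {K : ℕ} : Continuous (sumSqAffine (K := K)) := by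
  unfold sumSqAffine
  fun_prop

theorem bag_eq_sumSqAffine (p q : S → ℝ) {K m : ℕ} (G : Fin K → Set S) (t : Fin m → Obs S) :
    bag q G t =
      sumSqAffine (WithLp.toLp 2 fun k => stdSum p (G k) t, ratioBias p q G t) := by
  rw [bag_eq_sum_stdSum]
  exact Finset.sum_congr rfl fun k _ => by simp [ratioBias]

theorem measurable_ratioBias [MeasurableSpace S] {E : Type*} [MeasurableSpace E] {K m : ℕ}
    {G : E → Fin K → Set S} (hG : ∀ k, MeasurableSet {z : E × S | z.2 ∈ G z.1 k})
    {p : S → ℝ} (hp : Measurable p) {q : E → S → ℝ}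
    (hq : Measurable fun z : E × S => q z.1 z.2) :
    Measurable fun z : E × (Fin m → Obs S) => ratioBias p (q z.1) (G z.1) z.2 := by
  have hp' : Measurable fun z : E × S => (fun _ : E => p) z.1 z.2 := hp.comp measurable_snd
  have hratio := fun k =>
    (measurable_groupVar (m := m) (A := fun e => G e k) (q := fun _ => p) (hG k) hp').sqrt.div
    (measurable_groupVar (A := fun e => G e k) (hG k) hq).sqrt
  refine Measurable.prodMk (measurable_pi_lambda _ hratio) (measurable_pi_lambda _ fun k => ?_)
  exact (measurable_stdSum (A := fun e => G e k) (hG k) hq).sub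
    ((measurable_stdSum (A := fun e => G e k) (q := fun _ => p) (hG k) hp').mul (hratio k))

theorem tendstoInDistribution_id_of_map_eq {Ω Ω' ι : Type*} [MeasurableSpace Ω]
    [MeasurableSpace Ω'] {μ : Measure Ω} [IsProbabilityMeasure μ] {μ' : Measure Ω'}
    [IsProbabilityMeasure μ'] {l : Filter ι} {X : ι → Ω → ℝ} {Z : Ω' → ℝ} {ν : Measure ℝ}
    [IsProbabilityMeasure ν] (h : TendstoInDistribution X l Z (fun _ => μ) μ')
    (hν : μ'.map Z = ν) : TendstoInDistribution X l id (fun _ => μ) ν := by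
  subst hν
  refine ⟨h.forall_aemeasurable, aemeasurable_id, ?_⟩
  convert! h.tendsto using 2
  simp

section

variable {Ω : Type*} [MeasurableSpace Ω] {μ : Measure Ω} {K : ℕ}
  {E : ℕ → Type*} {n₂ : ℕ → ℕ} {d : ∀ n, Ω → E n} {t : ∀ n, Ω → Fin (n₂ n) → Obs S}
  {q : ∀ n, E n → S → ℝ} {G : ∀ n, E n → Fin K → Set S} {p : S → ℝ} {ρ : ℕ → ℝ} {c : ℝ}

/-- The characteristic functions of the standardized group sums converge to the standard normal
one. -/
theorem tendsto_integral_condCharFun [IsProbabilityMeasure μ]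
    [∀ n, MeasurableSpace (E n)] [MeasurableSpace S]
    (hpm : Measurable p) (hp : ∀ x, 0 ≤ p x ∧ p x ≤ 1)
    (hdt : ∀ n, Measurable fun ω => (d n ω, t n ω))
    (hG_part : ∀ n e, IsPartition (G n e))
    (hG : ∀ n k, MeasurableSet {z : E n × S | z.2 ∈ G n z.1 k}) (hc : 0 < c)
    (hreg : ∀ ε : ℝ, 0 < ε → ∃ κ M : ℝ, 0 < κ ∧ 0 < M ∧ ∀ᶠ n in atTop,
      μ {ω | ¬ IsRegular p (q n (d n ω)) (G n (d n ω)) (t n ω) c κ (M * ρ n)} ≤ ENNReal.ofReal ε)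
    (hn₂ : Tendsto n₂ atTop atTop) (u : Fin K → ℝ) :
    Tendsto (fun n => ∫ ω, condCharFun p (G n (d n ω)) u (t n ω) ∂μ) atTop
      (𝓝 (Complex.exp (-((∑ k, u k ^ 2) / 2 : ℝ)))) := by
  rw [Metric.tendsto_nhds]
  intro ε hε
  set U := ∑ k, u k ^ 2 with hU
  have hU0 : 0 ≤ U := Finset.sum_nonneg fun k _ => sq_nonneg _
  obtain ⟨κ, M, hκ, -, hM⟩ := hreg (ε / 8) (by positivity)
  -- With this `δ`, the bound `δ / c * U` for the favourable event is at most `ε / 4`.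
  -- With this `δ`, the bound `δ / c * U` for the favourable event is at most `ε / 4`.
  -- With this `δ`, the bound `δ / c * U` for the favourable event is at most `ε / 4`.
  set δ : ℝ := min 1 (ε * c / (4 * (U + 1))) with hδ
  have hδ0 : 0 < δ := lt_min one_pos (by positivity)
  have hδU : δ / c * U ≤ ε / 4 := by
    have h1 : δ ≤ ε * c / (4 * (U + 1)) := min_le_right _ _
    rw [le_div_iff₀ (by positivity)] at h1
    rw [div_mul_eq_mul_div, div_le_iff₀ hc]
    nlinarith
  have hcκ : Tendsto (fun n => c * (κ * (n₂ n : ℝ))) atTop atTop :=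
    ((tendsto_natCast_atTop_atTop.comp hn₂).const_mul_atTop hκ).const_mul_atTop hc
  have hlim : Tendsto (fun n => δ * √(c * (κ * (n₂ n : ℝ)))) atTop atTop :=
    (Real.tendsto_sqrt_atTop.comp hcκ).const_mul_atTop hδ0
  filter_upwards [hM, hcκ.eventually_gt_atTop 0, hlim.eventually_ge_atTop (∑ k, |u k|)]
    with n hn hpos hbig
  set e := Complex.exp (-((U / 2 : ℝ) : ℂ)) with he
  have he1 : ‖e‖ ≤ 1 := by
    rw [he, ← Complex.ofReal_neg, Complex.norm_exp_ofReal, Real.exp_le_one_iff]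
    linarith
  have hint : Integrable (fun ω => condCharFun p (G n (d n ω)) u (t n ω)) μ :=
    Integrable.of_bound (C := 1)
      ((measurable_condCharFun (hG n) hpm u).comp (hdt n)).aestronglyMeasurable
      (.of_forall fun ω => norm_condCharFun_le_one hp _ _ _)
  have hsub : (∫ ω, condCharFun p (G n (d n ω)) u (t n ω) ∂μ) - e =
      ∫ ω, (condCharFun p (G n (d n ω)) u (t n ω) - e) ∂μ := by
    rw [integral_sub hint (integrable_const _)]
    simp
  rw [dist_eq_norm, hsub]
  refine (norm_integral_le_of_measure_le (η := ε / 4) (ε := ε / 8) (by positivity) (by positivity)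
    (fun ω => ?_) hn fun ω hω => ?_).trans_lt (by linarith)
  · refine (norm_sub_le _ _).trans ?_
    linarith [norm_condCharFun_le_one hp (G n (d n ω)) u (t n ω)]
  · obtain ⟨hpc, hN, -⟩ := not_not.1 hω
    have hV : ∀ k, c * (κ * (n₂ n : ℝ)) ≤ groupVar p (G n (d n ω) k) (t n ω) := fun k =>
      (mul_le_mul_of_nonneg_left (hN k) hc.le).trans (mul_card_le_groupVar hpc _)
    refine (norm_condCharFun_sub_exp_le hp (hG_part n _) u (t n ω) hc hδ0.le (min_le_left _ _) hpc
      (fun k => hpos.trans_le (hV k)) fun k => ?_).trans hδU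
    calc |u k| ≤ ∑ k, |u k| :=
          Finset.single_le_sum (f := fun k => |u k|) (fun _ _ => abs_nonneg _) (Finset.mem_univ k)
      _ ≤ _ := hbig
      _ ≤ _ := by gcongr; exact hV k

/-- A conditional multivariate central limit theorem: the group sums standardized with the true
probability function are asymptotically independent standard normal variables. -/
theorem tendstoInDistribution_stdSum [IsProbabilityMeasure μ]
    [∀ n, MeasurableSpace (E n)] [MeasurableSpace S]
    (P : Measure (Obs S)) [IsProbabilityMeasure P] (hp : IsRegressionFunction P p)
    (hdt : ∀ n, Measurable fun ω => (d n ω, t n ω))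
    {ν : ∀ n, Measure (E n)} [∀ n, IsProbabilityMeasure (ν n)]
    (hlaw : ∀ n, μ.map (fun ω => (d n ω, t n ω)) = (ν n).prod (Measure.pi fun _ => P))
    (hG_part : ∀ n e, IsPartition (G n e))
    (hG : ∀ n k, MeasurableSet {z : E n × S | z.2 ∈ G n z.1 k}) (hc : 0 < c)
    (hreg : ∀ ε : ℝ, 0 < ε → ∃ κ M : ℝ, 0 < κ ∧ 0 < M ∧ ∀ᶠ n in atTop,
      μ {ω | ¬ IsRegular p (q n (d n ω)) (G n (d n ω)) (t n ω) c κ (M * ρ n)} ≤ ENNReal.ofReal ε)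
    (hn₂ : Tendsto n₂ atTop atTop) :
    TendstoInDistribution
      (fun n ω => WithLp.toLp 2 fun k => stdSum p (G n (d n ω) k) (t n ω)) atTop
      (WithLp.toLp 2 : (Fin K → ℝ) → EuclideanSpace ℝ (Fin K)) (fun _ => μ)
      (Measure.pi fun _ => gaussianReal 0 1) := by
  have hmeas : ∀ n, Measurable fun ω =>
      (WithLp.toLp 2 fun k => stdSum p (G n (d n ω) k) (t n ω) : EuclideanSpace ℝ (Fin K)) := by
    intro n
    refine (MeasurableEquiv.toLp 2 (Fin K → ℝ)).measurable.comp (measurable_pi_lambda _ fun k => ?_)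
    exact (measurable_stdSum (A := fun e => G n e k) (hG n k) (q := fun _ => p)
      (hp.1.comp measurable_snd)).comp (hdt n)
  have hlim : Measurable (WithLp.toLp 2 : (Fin K → ℝ) → EuclideanSpace ℝ (Fin K)) :=
    (MeasurableEquiv.toLp 2 (Fin K → ℝ)).measurable
  refine ⟨fun n => (hmeas n).aemeasurable, hlim.aemeasurable, ?_⟩
  refine ProbabilityMeasure.tendsto_of_tendsto_charFun fun u => ?_
  have hgauss : charFun ((Measure.pi fun _ : Fin K => gaussianReal 0 1).map (WithLp.toLp 2)) u =
      Complex.exp (-((∑ k, u k ^ 2) / 2 : ℝ)) := by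
    rw [charFun_pi]
    simp only [charFun_gaussianReal]
    rw [← Complex.exp_sum]
    congr 1
    push_cast
    rw [Finset.sum_div, ← Finset.sum_neg_distrib]
    exact Finset.sum_congr rfl fun k _ => by simp
  have hX : ∀ n, charFun (μ.map fun ω => (WithLp.toLp 2 fun k => stdSum p (G n (d n ω) k) (t n ω) :
      EuclideanSpace ℝ (Fin K))) u = ∫ ω, condCharFun p (G n (d n ω)) u (t n ω) ∂μ := by
    intro n
    rw [← integral_cexp_stdSum P hp (hdt n) (hlaw n) (hG_part n) (hG n) u, charFun_apply,
      integral_map (hmeas n).aemeasurable (by fun_prop)]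
    refine integral_congr_ae (.of_forall fun ω => ?_)
    simp [PiLp.inner_apply, mul_comm]
  have := tendsto_integral_condCharFun (μ := μ) hp.1 hp.2.1 hdt hG_part hG hc hreg hn₂ u
  rw [← hgauss] at this
  exact this.congr fun n => (hX n).symm

/-- In probability, the ratios tend to `1` and the biases to `0`. -/
theorem tendstoInMeasure_ratioBias (hp : ∀ x, 0 ≤ p x ∧ p x ≤ 1) (hc : 0 < c)
    (hreg : ∀ ε : ℝ, 0 < ε → ∃ κ M : ℝ, 0 < κ ∧ 0 < M ∧ ∀ᶠ n in atTop,
      μ {ω | ¬ IsRegular p (q n (d n ω)) (G n (d n ω)) (t n ω) c κ (M * ρ n)} ≤ ENNReal.ofReal ε)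
    (hn₂ : Tendsto n₂ atTop atTop) (hρ0 : ∀ n, 0 ≤ ρ n) (hρ : Tendsto ρ atTop (𝓝 0))
    (hρn : Tendsto (fun n => √(n₂ n) * ρ n) atTop (𝓝 0)) :
    TendstoInMeasure μ
      (fun n ω => ratioBias p (q n (d n ω)) (G n (d n ω)) (t n ω))
      atTop (fun _ => ((fun _ => 1 : Fin K → ℝ), (fun _ => 0 : Fin K → ℝ))) := by
  rw [tendstoInMeasure_iff_dist]
  intro η hη
  rw [ENNReal.tendsto_nhds_zero]
  intro ε hε
  obtain ⟨ε', hε', hle⟩ : ∃ ε' : ℝ, 0 < ε' ∧ ENNReal.ofReal ε' ≤ ε := by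
    obtain ⟨ε', h1, h2⟩ := ENNReal.lt_iff_exists_nnreal_btwn.1 hε
    exact ⟨ε', by exact_mod_cast h1, by rw [ENNReal.ofReal_coe_nnreal]; exact h2.le⟩
  obtain ⟨κ, M, hκ, hM0, hM⟩ := hreg ε' hε'
  have hκn : Tendsto (fun n => κ * (n₂ n : ℝ)) atTop atTop :=
    (tendsto_natCast_atTop_atTop.comp hn₂).const_mul_atTop hκ
  have hMρ : Tendsto (fun n => M * ρ n) atTop (𝓝 0) := by simpa using hρ.const_mul M
  have hl1 : Tendsto (fun n => 4 * (M * ρ n) / c) atTop (𝓝 0) := by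
    simpa using (hMρ.const_mul 4).div_const c
  have hl2 : Tendsto (fun n => √(2 / c) * (√(n₂ n) * (M * ρ n))) atTop (𝓝 0) := by
    have := hρn.const_mul (√(2 / c) * M)
    rw [mul_zero] at this
    refine this.congr fun n => by ring
  filter_upwards [hM, hκn.eventually_gt_atTop 0, hMρ.eventually_le_const one_pos,
    hMρ.eventually_le_const (show (0 : ℝ) < c / 4 by positivity), hl1.eventually_lt_const hη,
    hl2.eventually_lt_const hη] with n hn hpos h1 hc4 hη1 hη2
  refine (measure_mono fun ω hω => ?_).trans (hn.trans hle)
  rintro ⟨hpc, hN, hq⟩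
  have hMρ0 : 0 ≤ M * ρ n := mul_nonneg hM0.le (hρ0 n)
  have hN' : ∀ k, 0 < (members (t n ω) (G n (d n ω) k)).card := fun k =>
    Nat.cast_pos.1 (hpos.trans_le (hN k))
  have hA := fun k => abs_sqrt_groupVar_div_sub_one_le hp hc hpc hMρ0 h1 hc4 hq (hN' k)
  refine not_le.2 ?_ (show η ≤ dist _ _ from hω)
  rw [Prod.dist_eq, max_lt_iff, dist_pi_lt_iff hη, dist_pi_lt_iff hη]
  refine ⟨fun k => ?_, fun k => ?_⟩
  · rw [Real.dist_eq]
    exact (hA k).2.trans_lt hη1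
  · rw [Real.dist_eq, sub_zero]
    exact (abs_stdSum_sub_le hc hpc hMρ0 hq (hN' k) (hA k).1).trans_lt hη2

/-- Slutsky's theorem transfers the central limit theorem from the sums standardized with `p` to
those standardized with the fit `q`. -/
theorem tendstoInDistribution_bag [IsProbabilityMeasure μ]
    [∀ n, MeasurableSpace (E n)] [MeasurableSpace S]
    (P : Measure (Obs S)) [IsProbabilityMeasure P] (hp : IsRegressionFunction P p)
    (hdt : ∀ n, Measurable fun ω => (d n ω, t n ω))
    {ν : ∀ n, Measure (E n)} [∀ n, IsProbabilityMeasure (ν n)]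
    (hlaw : ∀ n, μ.map (fun ω => (d n ω, t n ω)) = (ν n).prod (Measure.pi fun _ => P))
    (hq : ∀ n, Measurable fun z : E n × S => q n z.1 z.2)
    (hG_part : ∀ n e, IsPartition (G n e))
    (hG : ∀ n k, MeasurableSet {z : E n × S | z.2 ∈ G n z.1 k}) (hc : 0 < c)
    (hreg : ∀ ε : ℝ, 0 < ε → ∃ κ M : ℝ, 0 < κ ∧ 0 < M ∧ ∀ᶠ n in atTop,
      μ {ω | ¬ IsRegular p (q n (d n ω)) (G n (d n ω)) (t n ω) c κ (M * ρ n)} ≤ ENNReal.ofReal ε)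
    (hn₂ : Tendsto n₂ atTop atTop) (hρ0 : ∀ n, 0 ≤ ρ n) (hρ : Tendsto ρ atTop (𝓝 0))
    (hρn : Tendsto (fun n => √(n₂ n) * ρ n) atTop (𝓝 0)) :
    TendstoInDistribution (fun n ω => bag (q n (d n ω)) (G n (d n ω)) (t n ω)) atTop
      (id : ℝ → ℝ) (fun _ => μ) (chiSquared K) := by
  have hZ := tendstoInDistribution_stdSum P hp hdt hlaw hG_part hG hc hreg hn₂
  have hY := tendstoInMeasure_ratioBias hp.2.1 hc hreg hn₂ hρ0 hρ hρn
  have h := hZ.continuous_comp_prodMk_of_tendstoInMeasure_const continuous_sumSqAffine hY fun n =>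
    ((measurable_ratioBias (hG n) hp.1 (hq n)).comp (hdt n)).aemeasurable
  simp only [← bag_eq_sumSqAffine] at h
  refine tendstoInDistribution_id_of_map_eq h ?_
  simp [sumSqAffine, chiSquared]

end

/-- Since `r` is positive, it can tend to `0` along `a` only if `a` tends to infinity. -/
theorem tendsto_atTop_of_tendsto_zero {r : ℕ → ℝ} (hr : ∀ m, 0 < r m) {a : ℕ → ℕ}
    (h : Tendsto (fun n => r (a n)) atTop (𝓝 0)) : Tendsto a atTop atTop := by
  rw [tendsto_atTop]
  intro b
  have h1 : ∀ᶠ x : ℝ in 𝓝 0, ∀ m ∈ Finset.range b, x < r m :=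
    (Finset.eventually_all _).2 fun m _ => eventually_lt_nhds (hr m)
  filter_upwards [h.eventually h1] with n hn
  by_contra hlt
  exact lt_irrefl _ (hn (a n) (Finset.mem_range.2 (not_le.1 hlt)))

theorem abs_sub_le_of_supDist_le {q p : S → ℝ} {ρ : ℝ} (hρ : 0 ≤ ρ)
    (h : supDist q p ≤ ENNReal.ofReal ρ) (x : S) : |q x - p x| ≤ ρ :=
  (ENNReal.ofReal_le_ofReal_iff hρ).1 ((le_iSup (fun x => ENNReal.ofReal |q x - p x|) x).trans h)

/-- The assumptions on the group sizes, on `p` and on the fit make the complement of the favourable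
event arbitrarily unlikely. -/
theorem eventually_measure_not_isRegular_le {Ω : Type*} [MeasurableSpace Ω] {μ : Measure Ω}
    [IsProbabilityMeasure μ] {K : ℕ} {E : ℕ → Type*} [∀ m, MeasurableSpace (E m)] {n₁ n₂ : ℕ → ℕ}
    {d : ∀ n, Ω → E (n₁ n)} {t : ∀ n, Ω → Fin (n₂ n) → Obs S} {q : ∀ m, E m → S → ℝ}
    {G : ∀ n, E (n₁ n) → Fin K → Set S} {p : S → ℝ} {r : ℕ → ℝ} {c : ℝ}
    (hd : ∀ n, Measurable (d n)) {ν : ∀ m, Measure (E m)}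
    (hlaw : ∀ n, μ.map (d n) = ν (n₁ n))
    (hsize : ∀ k, IsOmegap μ (fun n ω => (members (t n ω) (G n (d n ω) k)).card) n₂)
    (hbdd : ∀ n (i : Fin (n₂ n)), ∀ᵐ ω ∂μ, c ≤ p (t n ω i).1 ∧ p (t n ω i).1 ≤ 1 - c)
    (hr : ∀ m, 0 < r m) (hconv : IsBigOp ν (fun m e => supDist (q m e) p) r)
    (hn₁ : Tendsto n₁ atTop atTop) {ε : ℝ} (hε : 0 < ε) :
    ∃ κ M : ℝ, 0 < κ ∧ 0 < M ∧ ∀ᶠ n in atTop,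
      μ {ω | ¬ IsRegular p (q (n₁ n) (d n ω)) (G n (d n ω)) (t n ω) (c * (1 - c)) κ
        (M * r (n₁ n))} ≤ ENNReal.ofReal ε := by
  obtain ⟨M, hM0, hM⟩ := hconv (ε / 2) (by positivity)
  choose f hf0 hf using fun k => hsize k (ε / (2 * (K + 1))) (by positivity)
  obtain ⟨κ, hκf, hκ⟩ : ∃ κ : ℝ, (∀ k, κ ≤ f k) ∧ 0 < κ := by
    have h1 : ∀ᶠ x : ℝ in 𝓝[>] 0, ∀ k, x ≤ f k :=
      eventually_all.2 fun k => (eventually_le_nhds (hf0 k)).filter_mono nhdsWithin_le_nhds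
    exact (h1.and self_mem_nhdsWithin).exists
  refine ⟨κ, M, hκ, hM0, ?_⟩
  filter_upwards [hn₁.eventually hM, eventually_all.2 hf] with n hnM hnf
  set B₁ := {ω | ¬ ∀ i, c ≤ p (t n ω i).1 ∧ p (t n ω i).1 ≤ 1 - c}
  set B₂ := d n ⁻¹' {e | ENNReal.ofReal (M * r (n₁ n)) < supDist (q (n₁ n) e) p}
  set B₃ := fun k => {ω | ((members (t n ω) (G n (d n ω) k)).card : ℝ) < f k * (n₂ n : ℝ)}
  have hB₁ : μ B₁ = 0 := ae_iff.1 (ae_all_iff.2 (hbdd n))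
  have hB₂ : μ B₂ ≤ ENNReal.ofReal (ε / 2) := by
    refine (Measure.le_map_apply (hd n).aemeasurable _).trans ?_
    rw [hlaw n]
    exact hnM
  have hB₃ : μ (⋃ k, B₃ k) ≤ ENNReal.ofReal (ε / 2) := by
    refine (measure_iUnion_fintype_le μ B₃).trans ((Finset.sum_le_sum fun k _ => hnf k).trans ?_)
    rw [← ENNReal.ofReal_sum_of_nonneg fun _ _ => by positivity]
    refine ENNReal.ofReal_le_ofReal ?_
    rw [Finset.sum_const, Finset.card_univ, Fintype.card_fin, nsmul_eq_mul, mul_div_assoc',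
      div_le_div_iff₀ (by positivity) (by positivity)]
    nlinarith
  have hsub : {ω | ¬ IsRegular p (q (n₁ n) (d n ω)) (G n (d n ω)) (t n ω) (c * (1 - c)) κ
      (M * r (n₁ n))} ⊆ B₁ ∪ (B₂ ∪ ⋃ k, B₃ k) := by
    intro ω hω
    by_contra hno
    simp only [Set.mem_union, not_or, Set.mem_iUnion, not_exists] at hno
    obtain ⟨h1, h2, h3⟩ := hno
    refine hω ⟨fun i => ?_, fun k => ?_, ?_⟩
    · -- The function `x ↦ x * (1 - x)` is at least `c * (1 - c)` on `[c, 1 - c]`.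
      have := not_not.1 h1 i
      nlinarith [mul_nonneg (sub_nonneg.2 this.1) (sub_nonneg.2 this.2)]
    · refine le_trans ?_ (not_lt.1 (h3 k))
      gcongr
      exact hκf k
    · exact abs_sub_le_of_supDist_le (mul_pos hM0 (hr _)).le (not_lt.1 h2)
  refine (measure_mono hsub).trans ((measure_union_le _ _).trans ?_)
  rw [hB₁, zero_add]
  refine (measure_union_le _ _).trans ((add_le_add hB₂ hB₃).trans ?_)
  rw [← ENNReal.ofReal_add (by positivity) (by positivity), add_halves]

end BAGofT

theorem theorem1
    -- covariate space and population distribution of one observation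
    {S : Type*} [MeasurableSpace S]
    (P : Measure (BAGofT.Obs S)) [IsProbabilityMeasure P]
    -- the true probability function `p x = P(Y = 1 | X = x)`
    (p : S → ℝ) (hp : BAGofT.IsRegressionFunction P p)
    -- the i.i.d. observations
    {Ω : Type*} [MeasurableSpace Ω] (μ : Measure Ω) [IsProbabilityMeasure μ]
    (D : Ω → ℕ → BAGofT.Obs S)
    (hD_meas : ∀ i, Measurable fun ω => D ω i)
    (hD_law : ∀ i, μ.map (fun ω => D ω i) = P)
    (hD_indep : iIndepFun (fun i ω => D ω i) μ)
    -- the random split of the first `n` observations, independent of the data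
    (n₁ n₂ : ℕ → ℕ)
    (split : ∀ n, Ω → BAGofT.Split (n₁ n) (n₂ n) n)
    (hsplit_meas : ∀ n, Measurable (split n))
    (hsplit_indep : ∀ n, IndepFun (split n) D μ)
    -- the fitted probability computed from a sample of size `m`
    (phat : ∀ m, (Fin m → BAGofT.Obs S) → S → ℝ)
    (hphat_meas : ∀ m, Measurable fun z : (Fin m → BAGofT.Obs S) × S => phat m z.1 z.2)
    -- the partition into `K` groups computed from the training set
    (K : ℕ)
    (G : ∀ n, (Fin (n₁ n) → BAGofT.Obs S) → Fin K → Set S)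
    (hG_part : ∀ n d, BAGofT.IsPartition (G n d))
    (hG_meas : ∀ n k,
      MeasurableSet {z : (Fin (n₁ n) → BAGofT.Obs S) × S | z.2 ∈ G n z.1 k})
    -- null hypothesis: the true probability function belongs to the model to assess
    (model : Set (S → ℝ)) (hnull : p ∈ model)
    -- each group receives a number of test observations of order `n₂`
    (hsize : ∀ k, BAGofT.IsOmegap μ
      (fun n ω => (BAGofT.members (BAGofT.testSet (D ω) (split n ω))
        (G n (BAGofT.trainingSet (D ω) (split n ω)) k)).card) n₂)
    -- the true probabilities at the test points are bounded away from 0 and 1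
    (hbdd : ∃ c : ℝ, 0 < c ∧ c < 1 / 2 ∧ ∀ n (i : Fin (n₂ n)), ∀ᵐ ω ∂μ,
      c ≤ p (BAGofT.testSet (D ω) (split n ω) i).1 ∧
        p (BAGofT.testSet (D ω) (split n ω) i).1 ≤ 1 - c)
    -- under the null hypothesis, the fit to `m` i.i.d. observations converges uniformly at rate `r`
    (r : ℕ → ℝ) (hr_pos : ∀ m, 0 < r m) (hr_zero : Tendsto r atTop (𝓝 0))
    (hconv : p ∈ model → BAGofT.IsBigOp (fun m => Measure.pi fun _ : Fin m => P)
      (fun m d => BAGofT.supDist (phat m d) p) r)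
    -- the splitting ratio
    (hn₂ : Tendsto n₂ atTop atTop)
    (hratio : Tendsto (fun n => (n₂ n : ℝ) * r (n₁ n) ^ 2) atTop (𝓝 0)) :
    TendstoInDistribution
      (fun n ω => BAGofT.bag (phat (n₁ n) (BAGofT.trainingSet (D ω) (split n ω)))
        (G n (BAGofT.trainingSet (D ω) (split n ω)))
        (BAGofT.testSet (D ω) (split n ω)))
      atTop (id : ℝ → ℝ) (fun _ => μ) (BAGofT.chiSquared K) := by
  have hMap := fun n => BAGofT.map_trainingSet_testSet P μ D hD_meas hD_law hD_indep (split n)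
    (hsplit_meas n) (hsplit_indep n)
  obtain ⟨c, hc0, hc1, hc⟩ := hbdd
  have hroot : Tendsto (fun n => √(n₂ n) * r (n₁ n)) atTop (𝓝 0) := by
    have h := hratio.sqrt
    rw [Real.sqrt_zero] at h
    refine h.congr fun n => ?_
    rw [Real.sqrt_mul (Nat.cast_nonneg _), Real.sqrt_sq (hr_pos _).le]
  -- Since `n₂ ≥ 1` eventually, this forces `r (n₁ n) → 0`, and hence `n₁ → ∞`.
  have hr₁ : Tendsto (fun n => r (n₁ n)) atTop (𝓝 0) := by
    refine squeeze_zero' (.of_forall fun n => (hr_pos _).le) ?_ hroot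
    filter_upwards [hn₂.eventually_ge_atTop 1] with n hn
    exact le_mul_of_one_le_left (hr_pos _).le (Real.one_le_sqrt.2 (by exact_mod_cast hn))
  refine BAGofT.tendstoInDistribution_bag (E := fun n => Fin (n₁ n) → BAGofT.Obs S) (n₂ := n₂)
    (p := p) (c := c * (1 - c)) (ρ := fun n => r (n₁ n))
    (d := fun n ω => BAGofT.trainingSet (D ω) (split n ω))
    (t := fun n ω => BAGofT.testSet (D ω) (split n ω)) (q := fun n => phat (n₁ n)) (G := G)
    (ν := fun n => Measure.pi fun _ : Fin (n₁ n) => P)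
    P hp (fun n => (hMap n).1) (fun n => (hMap n).2) (fun n => hphat_meas _) hG_part hG_meas
    (mul_pos hc0 (by linarith)) ?_ hn₂ (fun n => (hr_pos _).le) hr₁ hroot
  intro ε hε
  refine BAGofT.eventually_measure_not_isRegular_le (E := fun m => Fin m → BAGofT.Obs S)
    (n₁ := n₁) (n₂ := n₂) (q := phat) (G := G)
    (d := fun n ω => BAGofT.trainingSet (D ω) (split n ω))
    (ν := fun m => Measure.pi fun _ : Fin m => P)
    (fun n => measurable_fst.comp (hMap n).1) (fun n => ?_) hsize hc hr_pos (hconv hnull)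
    (BAGofT.tendsto_atTop_of_tendsto_zero hr_pos hr₁) hε
  have h := congrArg (Measure.map Prod.fst) (hMap n).2
  rw [Measure.map_map measurable_fst (hMap n).1, Measure.map_fst_prod, measure_univ, one_smul] at h
  exact h
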